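/- Let $0<\alpha<1$ be a constant. For each $n$ let $m=m(n)$ be a natural number with $|m-n^{\alpha}|<1$ (that is, $m=n^{\alpha}$ up to rounding) and let $p=p(n)\in[0,1]$ satisfy $p=\Omega\left(\sqrt{1/(nm)}\right)$ and $mp^2=O(1)$ as $n\to\infty$. Let $G_{n,m,p}$ be the random intersection graph: each vertex $v$ of a set of $n$ vertices independently receives a random set $S_v\subseteq\{1,\dots,m\}$ containing each label independently with probability $p$, and two vertices $v\neq u$ are adjacent if and only if $S_v\cap S_u\neq\emptyset$. Then with high probability the maximum clique $Q$ of $G_{n,m,p}$ satisfies $|Q|\sim np$; that is, for every $\varepsilon>0$, with probability tending to $1$ as $n\to\infty$, every maximum clique $Q$ of $G_{n,m,p}$ satisfies $\bigl||Q|-np\bigr|\le\varepsilon np$, and hence the clique number $\omega(G_{n,m,p})$ satisfies $|\omega(G_{n,m,p})-np|\le\varepsilon np$. -/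

import Mathlib

open Filter Asymptotics MeasureTheory

/-- The intersection graph of a family `S` of label sets: two distinct vertices `v`, `u` are
adjacent if and only if their label sets `S v`, `S u` have a common element. -/
def intersectionGraph {V M : Type*} (S : V → Set M) : SimpleGraph V where
  Adj v u := v ≠ u ∧ (S v ∩ S u).Nonempty
  symm := ⟨fun v u h => ⟨h.1.symm, by rw [Set.inter_comm]; exact h.2⟩⟩
  loopless := ⟨fun _ h => h.1 rfl⟩

/-- The law of the label choices in the random intersection graphs model with `n` vertices and `m`
labels: independently for every vertex, a random set of labels is chosen that contains each label
independently with probability `p`. The random graph `G_{n,m,p}` is `intersectionGraph S` for `S`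
drawn from this law. -/
noncomputable def labelLaw (n m : ℕ) (p : unitInterval) : Measure (Fin n → Set (Fin m)) :=
  Measure.pi fun _ : Fin n => ProbabilityTheory.setBernoulli (Set.univ : Set (Fin m)) p

instance (n m : ℕ) (p : unitInterval) : IsProbabilityMeasure (labelLaw n m p) := by
  unfold labelLaw; infer_instance

/-! The holders of a single label form a clique, and by Chernoff bounds every label has about `np`
holders. This gives the lower bound; what remains is to show that no clique is much larger.

Let `r = ⌈n ^ γ⌉` with `γ` small. Since `mp² = O(1)`, with high probability any two label sets share
at most `r` labels, and every label set has size at most `s`, of order `1/p`. A clique with more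
than `(1 + 2δ)np` members then has, for each label, at least `r` members missing it. Such a clique
contains a set `T` of only `2r + 4r⁴` vertices with the same property (`exists_spread_subset`), and
all its other members are common neighbours of `T`.

Reveal the label sets on `T`. At most `d = O(r⁹)` labels are repeated among them; outside these the
sets are disjoint, and a fresh random set hits each of them independently with probability at most
`q = 1 - (1 - p)^s`, which is bounded away from `1`. So a fresh vertex is adjacent to all of `T`
only if it holds two repeated labels, or one repeated label and hits `r` disjoint sets, or hits all
the disjoint parts. The total chance `d²p² + dpq^r + q^r` is at most `p/12`
(`setBernoulli_real_forall_nonempty_le`). Hence `T` has `np/2` common neighbours with probability at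
most `exp(-np/4)`, which beats the `n^(2r + 4r⁴) ≤ exp(6r⁵)` choices of `T`, as `np` grows like a
power of `n` exceeding `r⁵`. Large cliques would thus have fewer than `np` members, a contradiction.
-/

open ProbabilityTheory

/-! ### Independence of labels inside one random set -/

section RandomSet

variable {M : Type*} [Fintype M] (p : unitInterval)

theorem map_mem_setBernoulli :
    (setBernoulli (Set.univ : Set M) p).map (fun s l => l ∈ s) =
      Measure.infinitePi fun _ : M => (unitInterval.toNNReal p • Measure.dirac True +
        unitInterval.toNNReal (unitInterval.symm p) • Measure.dirac False) := by
  rw [setBernoulli_eq_map, Measure.map_map .of_discrete .of_discrete]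
  simp only [Set.mem_univ]
  exact Measure.map_id

theorem map_eval_mem_setBernoulli (l : M) :
    (setBernoulli (Set.univ : Set M) p).map (fun s => l ∈ s) =
      unitInterval.toNNReal p • Measure.dirac True +
        unitInterval.toNNReal (unitInterval.symm p) • Measure.dirac False := by
  have h := congrArg (Measure.map (fun f : M → Prop => f l)) (map_mem_setBernoulli (M := M) p)
  rw [Measure.map_map .of_discrete .of_discrete] at h
  refine h.trans ?_
  exact Measure.infinitePi_map_eval (μ := fun _ : M => (unitInterval.toNNReal p • Measure.dirac True +
        unitInterval.toNNReal (unitInterval.symm p) • Measure.dirac False)) l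

theorem iIndepFun_mem_setBernoulli :
    iIndepFun (fun (l : M) (s : Set M) => l ∈ s) (setBernoulli (Set.univ : Set M) p) := by
  rw [iIndepFun_iff_map_fun_eq_infinitePi_map fun _ => .of_discrete, map_mem_setBernoulli]
  simp only [map_eval_mem_setBernoulli]

theorem setBernoulli_real_mem (l : M) :
    (setBernoulli (Set.univ : Set M) p).real {s | l ∈ s} = p := by
  have h : (setBernoulli (Set.univ : Set M) p) {s | l ∈ s} =
      ((setBernoulli (Set.univ : Set M) p).map (fun s => l ∈ s)) {True} := by
    rw [Measure.map_apply .of_discrete .of_discrete]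
    congr 1; ext s; simp
  rw [measureReal_def, h, map_eval_mem_setBernoulli]
  simp

theorem setBernoulli_real_notMem (l : M) :
    (setBernoulli (Set.univ : Set M) p).real {s | l ∉ s} = 1 - p := by
  rw [← setBernoulli_real_mem p l, ← probReal_compl_eq_one_sub .of_discrete]
  rfl

theorem setBernoulli_real_disjoint (B : Finset M) :
    (setBernoulli (Set.univ : Set M) p).real {s | ∀ l ∈ B, l ∉ s} = (1 - (p : ℝ)) ^ B.card := by
  have h := (iIndepFun_mem_setBernoulli (M := M) p).measure_inter_preimage_eq_mul B
    (sets := fun _ => {False}) (fun _ _ => .of_discrete)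
  have h1 : (⋂ l ∈ B, (fun s : Set M => l ∈ s) ⁻¹' {False}) = {s | ∀ l ∈ B, l ∉ s} := by
    ext s; simp
  have h2 : ∀ l : M, (fun s : Set M => l ∈ s) ⁻¹' {False} = {s | l ∉ s} := by
    intro l; ext s; simp
  rw [h1] at h
  simp only [h2] at h
  rw [measureReal_def, h, ENNReal.toReal_prod]
  simp only [← measureReal_def, setBernoulli_real_notMem, Finset.prod_const]

theorem setBernoulli_real_hits (B : Finset M) :
    (setBernoulli (Set.univ : Set M) p).real {s | ∃ l ∈ B, l ∈ s} =
      1 - (1 - (p : ℝ)) ^ B.card := by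
  rw [← setBernoulli_real_disjoint, ← probReal_compl_eq_one_sub .of_discrete]
  congr 1; ext s; simp

/-- A random set hits pairwise disjoint blocks independently. -/
theorem setBernoulli_real_forall_hits {ι : Type*} (U : Finset ι) (B : ι → Finset M)
    (hB : (U : Set ι).PairwiseDisjoint B) :
    (setBernoulli (Set.univ : Set M) p).real {s | ∀ i ∈ U, ∃ l ∈ B i, l ∈ s} =
      ∏ i ∈ U, (1 - (1 - (p : ℝ)) ^ (B i).card) := by
  classical
  induction U using Finset.induction_on with
  | empty => simp
  | insert a U ha ih =>
    have hdisj : Disjoint (B a) (U.biUnion B) := by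
      rw [Finset.disjoint_biUnion_right]
      intro i hi
      exact hB (by simp) (by simp [hi]) (fun h => ha (h ▸ hi))
    have hind := (iIndepFun_mem_setBernoulli (M := M) p).indepFun_finset _ _ hdisj
      (fun _ => .of_discrete)
    have h := hind.measure_inter_preimage_eq_mul
      {f | ∃ l, f l} {f | ∀ i (hi : i ∈ U), ∃ l, ∃ hl : l ∈ B i,
        f ⟨l, Finset.mem_biUnion.2 ⟨i, hi, hl⟩⟩} .of_discrete .of_discrete
    rw [Finset.prod_insert ha, ← ih (hB.subset (by simp)), ← setBernoulli_real_hits]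
    simp only [measureReal_def, ← ENNReal.toReal_mul]
    congr 1
    convert h using 2
    · ext s; simp
    · congr 1; ext s; simp
    · congr 1; ext s; simp

theorem setBernoulli_real_subset (A : Finset M) :
    (setBernoulli (Set.univ : Set M) p).real {s | ∀ l ∈ A, l ∈ s} = (p : ℝ) ^ A.card := by
  have h := setBernoulli_real_forall_hits p A (fun l => {l}) (by
    intro a _ b _ hab; simpa using hab)
  simpa using h

end RandomSet

/-! ### A binomial tail estimate -/

section Tail

/-- The left side is the union bound for a binomial variable reaching `k`. Pulling out `exp (-k)`
leaves a single term of the exponential series of `e * N * q`, and `e ≤ 3`. -/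
theorem choose_mul_pow_le_exp (N k : ℕ) {q : ℝ} (hq : 0 ≤ q) :
    (N.choose k : ℝ) * q ^ k ≤ Real.exp (3 * (N * q) - k) := by
  have h1 : (N.choose k : ℝ) ≤ (N : ℝ) ^ k / k.factorial := Nat.choose_le_pow_div k N
  have he : Real.exp 1 ≤ 3 := by linarith [Real.exp_one_lt_d9]
  calc (N.choose k : ℝ) * q ^ k ≤ (N : ℝ) ^ k / k.factorial * q ^ k := by gcongr
    _ = (Real.exp 1 * (N * q)) ^ k / k.factorial * Real.exp (-k) := by
      have : Real.exp (-k) = (Real.exp 1 ^ k)⁻¹ := by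
        rw [Real.exp_neg, ← Real.exp_nat_mul, mul_one]
      rw [this, mul_pow, mul_pow]
      field_simp
    _ ≤ Real.exp (Real.exp 1 * (N * q)) * Real.exp (-k) := by
      gcongr
      exact Real.pow_div_factorial_le_exp _ (by positivity) k
    _ ≤ Real.exp (3 * (N * q)) * Real.exp (-k) := by gcongr
    _ = _ := by rw [← Real.exp_add]; ring_nf

end Tail

/-! ### Random sets that hit a whole family -/

section Hits

variable {M : Type*} [Fintype M] (p : unitInterval)

theorem setBernoulli_real_card_ge_le (k : ℕ) :
    (setBernoulli (Set.univ : Set M) p).real {s | k ≤ s.ncard} ≤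
      Real.exp (3 * (Fintype.card M * p) - k) := by
  classical
  refine le_trans ?_ (choose_mul_pow_le_exp (Fintype.card M) k p.2.1)
  have hsub : {s : Set M | k ≤ s.ncard} ⊆
      ⋃ A ∈ (Finset.univ : Finset M).powersetCard k, {s | ∀ l ∈ A, l ∈ s} := by
    intro s hs
    obtain ⟨A, hA, hAk⟩ := Finset.exists_subset_card_eq
      (show k ≤ s.toFinset.card by rw [← Set.ncard_eq_toFinset_card']; exact hs)
    simp only [Set.mem_iUnion]
    exact ⟨A, by simp [hAk], fun l hl => by simpa using hA hl⟩
  refine (measureReal_mono hsub (measure_ne_top _ _)).trans ((measureReal_biUnion_finset_le _ _).trans ?_)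
  rw [Finset.sum_congr rfl (g := fun _ => (p : ℝ) ^ k)]
  · simp
  · intro A hA
    rw [setBernoulli_real_subset, (Finset.mem_powersetCard.1 hA).2]

/-- The chance that a random set hits every member of a family of small sets, when few points are
repeated in the family and no point lies in almost all of its members. -/
theorem setBernoulli_real_forall_nonempty_le {ι : Type*} [Fintype ι] (A : ι → Set M) (D : Finset M)
    (hD : ∀ i j l, i ≠ j → l ∈ A i → l ∈ A j → l ∈ D) {d r s : ℕ} (hd : D.card ≤ d)
    (hs : ∀ i, (A i).ncard ≤ s) (hr : r ≤ Fintype.card ι)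
    (hl : ∀ l, r ≤ {i | l ∉ A i}.ncard) :
    (setBernoulli (Set.univ : Set M) p).real {S | ∀ i, (S ∩ A i).Nonempty} ≤
      d ^ 2 * (p : ℝ) ^ 2 + d * (p * (1 - (1 - (p : ℝ)) ^ s) ^ r) + (1 - (1 - (p : ℝ)) ^ s) ^ r := by
  classical
  set μ := setBernoulli (Set.univ : Set M) p
  set q : ℝ := 1 - (1 - (p : ℝ)) ^ s with hq
  have hp0 : (0 : ℝ) ≤ p := p.2.1
  have hp1 : (p : ℝ) ≤ 1 := p.2.2
  have hq0 : 0 ≤ q := sub_nonneg.2 (pow_le_one₀ (by linarith) (by linarith))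
  have hq1 : q ≤ 1 := by
    have : 0 ≤ (1 - (p : ℝ)) ^ s := pow_nonneg (by linarith) _
    linarith
  -- The private parts of the sets: pairwise disjoint, since every shared label lies in `D`.
  let B : ι → Finset M := fun i => (A i).toFinset \ D
  have hBq : ∀ i, 1 - (1 - (p : ℝ)) ^ (B i).card ≤ q := by
    intro i
    have h1 : (B i).card ≤ s := by
      refine (Finset.card_le_card Finset.sdiff_subset).trans ?_
      rw [← Set.ncard_eq_toFinset_card']
      exact hs i
    have := pow_le_pow_of_le_one (show 0 ≤ 1 - (p : ℝ) by linarith) (by linarith) h1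
    linarith
  have hB0 : ∀ i, 0 ≤ 1 - (1 - (p : ℝ)) ^ (B i).card := fun i =>
    sub_nonneg.2 (pow_le_one₀ (by linarith) (by linarith))
  have hBdisj : ∀ i j, i ≠ j → Disjoint (B i) (B j) := by
    intro i j hij
    rw [Finset.disjoint_left]
    intro l hi hj
    simp only [B, Finset.mem_sdiff, Set.mem_toFinset] at hi hj
    exact hi.2 (hD i j l hij hi.1 hj.1)
  have hprod : ∀ U : Finset ι, r ≤ U.card → ∏ i ∈ U, (1 - (1 - (p : ℝ)) ^ (B i).card) ≤ q ^ r := by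
    intro U hU
    calc ∏ i ∈ U, (1 - (1 - (p : ℝ)) ^ (B i).card) ≤ ∏ i ∈ U, q :=
          Finset.prod_le_prod (fun i _ => hB0 i) (fun i _ => hBq i)
      _ = q ^ U.card := by simp
      _ ≤ q ^ r := pow_le_pow_of_le_one hq0 hq1 hU
  let U : M → Finset ι := fun l => Finset.univ.filter fun i => l ∉ A i
  have hU : ∀ l, r ≤ (U l).card := by
    intro l
    have := hl l
    rwa [Set.ncard_eq_toFinset_card', Set.toFinset_ofPred] at this
  -- The cases are: two labels of `D` are chosen, one label `l` of `D` is chosen, none is. In the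
  -- second, the members avoiding `l` must be hit in their private parts; in the third, all members
  -- must.
  let E1 : Set (Set M) := ⋃ x ∈ D.offDiag, {S | ∀ l ∈ ({x.1, x.2} : Finset M), l ∈ S}
  let E2 : Set (Set M) := ⋃ l ∈ D, {S | l ∈ S ∧ ∀ i ∈ U l, ∃ l' ∈ B i, l' ∈ S}
  let E3 : Set (Set M) := {S | ∀ i ∈ Finset.univ, ∃ l' ∈ B i, l' ∈ S}
  have hsub : {S : Set M | ∀ i, (S ∩ A i).Nonempty} ⊆ E1 ∪ E2 ∪ E3 := by
    intro S hS
    by_cases h1 : ∃ l ∈ D, l ∈ S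
    · obtain ⟨l, hlD, hlS⟩ := h1
      by_cases h2 : ∃ l' ∈ D, l' ≠ l ∧ l' ∈ S
      · obtain ⟨l', hl'D, hne, hl'S⟩ := h2
        left; left
        simp only [E1, Set.mem_iUnion]
        exact ⟨(l, l'), by simp [hlD, hl'D, hne.symm], by simp [hlS, hl'S]⟩
      · left; right
        simp only [E2, Set.mem_iUnion]
        refine ⟨l, hlD, hlS, fun i hi => ?_⟩
        obtain ⟨x, hxS, hxA⟩ := hS i
        refine ⟨x, ?_, hxS⟩
        have hi' : l ∉ A i := by simpa [U] using hi
        simp only [B, Finset.mem_sdiff, Set.mem_toFinset]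
        refine ⟨hxA, fun hxD => h2 ⟨x, hxD, ?_, hxS⟩⟩
        rintro rfl
        exact hi' hxA
    · right
      intro i _
      obtain ⟨x, hxS, hxA⟩ := hS i
      refine ⟨x, ?_, hxS⟩
      simp only [B, Finset.mem_sdiff, Set.mem_toFinset]
      exact ⟨hxA, fun hxD => h1 ⟨x, hxD, hxS⟩⟩
  have hE1 : μ.real E1 ≤ d ^ 2 * (p : ℝ) ^ 2 := by
    refine (measureReal_biUnion_finset_le _ _).trans ?_
    rw [Finset.sum_congr rfl (g := fun _ => (p : ℝ) ^ 2)]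
    · rw [Finset.sum_const, nsmul_eq_mul]
      gcongr
      rw [Finset.offDiag_card]
      have : D.card * D.card - D.card ≤ d ^ 2 := by
        rw [pow_two]
        exact (Nat.sub_le _ _).trans (Nat.mul_le_mul hd hd)
      exact_mod_cast this
    · intro x hx
      rw [setBernoulli_real_subset, Finset.card_pair (Finset.mem_offDiag.1 hx).2.2]
  have hE2 : μ.real E2 ≤ d * (p * q ^ r) := by
    refine (measureReal_biUnion_finset_le _ _).trans ?_
    refine (Finset.sum_le_card_nsmul _ _ (p * q ^ r) ?_).trans ?_
    · intro l hlD
      -- The extra index `none` carries the block `{l}`, disjoint from the private parts because `l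
      -- ∈ D`; this yields the factor `p`.
      have h := setBernoulli_real_forall_hits p (Finset.insertNone (U l))
        (fun o => Option.elim o {l} B) (by
          intro a _ b _ hab
          cases a <;> cases b
          · exact absurd rfl hab
          · simp [Function.onFun, B, hlD]
          · simp [Function.onFun, B, hlD]
          · exact hBdisj _ _ (fun h => hab (by rw [h])))
      rw [Finset.prod_insertNone] at h
      simp only [Option.elim_none, Option.elim_some, Finset.card_singleton, pow_one,
        sub_sub_cancel] at h
      refine le_trans (le_of_eq ?_) (h.le.trans (mul_le_mul_of_nonneg_left (hprod _ (hU l)) hp0))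
      congr 1
      ext S
      change _ ↔ ∀ i ∈ Finset.insertNone (U l), _
      rw [Finset.forall_mem_insertNone]
      simp
    · rw [nsmul_eq_mul]
      gcongr
  have hE3 : μ.real E3 ≤ q ^ r := by
    have h := setBernoulli_real_forall_hits p Finset.univ B (fun i _ j _ hij => hBdisj i j hij)
    exact h.le.trans (hprod _ (by simpa using hr))
  calc μ.real {S | ∀ i, (S ∩ A i).Nonempty} ≤ μ.real (E1 ∪ E2 ∪ E3) := measureReal_mono hsub
    _ ≤ μ.real (E1 ∪ E2) + μ.real E3 := measureReal_union_le _ _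
    _ ≤ μ.real E1 + μ.real E2 + μ.real E3 := by gcongr; exact measureReal_union_le _ _
    _ ≤ _ := by gcongr

end Hits

/-! ### Independent vertices: conditioning and Chernoff bounds -/

section Product

variable {V Ω : Type*} [Fintype V] [MeasurableSpace Ω] (μ : Measure Ω) [IsProbabilityMeasure μ]

theorem pi_real_eval [DiscreteMeasurableSpace Ω] (v : V) (E : Set Ω) :
    (Measure.pi fun _ : V => μ).real {S | S v ∈ E} = μ.real E := by
  have h := (measurePreserving_eval (fun _ : V => μ) v).measure_preimage
    (s := E) MeasurableSet.of_discrete.nullMeasurableSet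
  rw [measureReal_def, measureReal_def, ← h]
  rfl

theorem pi_real_cylinder (E : V → Set Ω) :
    (Measure.pi fun _ : V => μ).real {S | ∀ v, S v ∈ E v} = ∏ v, μ.real (E v) := by
  have h : {S : V → Ω | ∀ v, S v ∈ E v} = Set.pi Set.univ E := by ext S; simp
  rw [h, measureReal_def, Measure.pi_pi, ENNReal.toReal_prod]
  rfl

/-- A union bound for the number of coordinates outside `T` that fall into a set `H` which depends
on the coordinates in `T`. -/
theorem pi_real_card_ge_le [Finite Ω] [DiscreteMeasurableSpace Ω] (T : Finset V) (good : (T → Ω) → Prop) (H : (T → Ω) → Set Ω)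
    {q : ℝ} (hH : ∀ a, good a → μ.real (H a) ≤ q) (hq : 0 ≤ q) (k : ℕ) :
    (Measure.pi fun _ : V => μ).real
        {S | good (fun v => S v) ∧ k ≤ {u | u ∉ T ∧ S u ∈ H (fun v => S v)}.ncard} ≤
      (Fintype.card V).choose k * q ^ k := by
  classical
  have := Fintype.ofFinite Ω
  set P := Measure.pi fun _ : V => μ
  let W : Finset (Finset V) := (Finset.univ \ T).powersetCard k
  -- Conditioning by enumeration: on the cylinder of `a` and `U` the coordinates in `T` are frozen
  -- to `a`, so `H a` is a fixed set, and those in `U` fall into it independently.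
  let E : (T → Ω) → Finset V → V → Set Ω := fun a U v =>
    if h : v ∈ T then {a ⟨v, h⟩} else if v ∈ U then H a else Set.univ
  let G : Finset (T → Ω) := Finset.univ.filter good
  have hsub : {S : V → Ω | good (fun v => S v) ∧ k ≤ {u | u ∉ T ∧ S u ∈ H (fun v => S v)}.ncard} ⊆
      ⋃ a ∈ G, ⋃ U ∈ W, {S | ∀ v, S v ∈ E a U v} := by
    rintro S ⟨hg, hk⟩
    rw [Set.ncard_eq_toFinset_card'] at hk
    obtain ⟨U, hU, hUk⟩ := Finset.exists_subset_card_eq hk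
    simp only [Set.mem_iUnion]
    refine ⟨fun v => S v, by simpa [G] using hg, U, ?_, ?_⟩
    · simp only [W, Finset.mem_powersetCard]
      refine ⟨fun u hu => ?_, hUk⟩
      have := hU hu
      simp only [Set.mem_toFinset] at this
      simpa using this.1
    · intro v
      simp only [E]
      split_ifs with h1 h2
      · simp
      · have := hU h2
        simp only [Set.mem_toFinset] at this
        exact this.2
      · trivial
  have hcyl : ∀ a ∈ G, ∀ U ∈ W, P.real {S | ∀ v, S v ∈ E a U v} ≤ (∏ v, μ.real {a v}) * q ^ k := by
    intro a ha U hU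
    rw [pi_real_cylinder]
    have ha' : good a := by simpa [G] using ha
    obtain ⟨hUT, hUk⟩ := Finset.mem_powersetCard.1 hU
    rw [← Finset.prod_mul_prod_compl T]
    refine mul_le_mul ?_ ?_ (Finset.prod_nonneg fun _ _ => measureReal_nonneg)
      (Finset.prod_nonneg fun _ _ => measureReal_nonneg)
    · rw [← Finset.prod_coe_sort]
      refine le_of_eq (Finset.prod_congr rfl fun v _ => ?_)
      simp [E]
    · have hUT' : U ⊆ Tᶜ := by rwa [Finset.compl_eq_univ_sdiff]
      rw [← Finset.prod_sdiff hUT']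
      calc _ ≤ 1 * ∏ v ∈ U, q := by
            refine mul_le_mul (Finset.prod_le_one (fun _ _ => measureReal_nonneg)
              fun _ _ => measureReal_le_one) (Finset.prod_le_prod (fun _ _ => measureReal_nonneg)
              fun v hv => ?_) (Finset.prod_nonneg fun _ _ => measureReal_nonneg) zero_le_one
            have : v ∉ T := Finset.mem_compl.1 (hUT' hv)
            simp only [E, this, hv, dite_false, if_true]
            exact hH a ha'
        _ = q ^ k := by simp [hUk]
  calc _ ≤ P.real (⋃ a ∈ G, ⋃ U ∈ W, {S | ∀ v, S v ∈ E a U v}) :=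
        measureReal_mono hsub (measure_ne_top _ _)
    _ ≤ ∑ a ∈ G, ∑ U ∈ W, P.real {S | ∀ v, S v ∈ E a U v} :=
        (measureReal_biUnion_finset_le _ _).trans
          (Finset.sum_le_sum fun _ _ => measureReal_biUnion_finset_le _ _)
    _ ≤ ∑ a ∈ G, ∑ U ∈ W, (∏ v, μ.real {a v}) * q ^ k :=
        Finset.sum_le_sum fun a ha => Finset.sum_le_sum fun U hU => hcyl a ha U hU
    _ = (∑ a ∈ G, ∏ v, μ.real {a v}) * (W.card * q ^ k) := by
        simp only [Finset.sum_const, nsmul_eq_mul, Finset.sum_mul]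
        exact Finset.sum_congr rfl fun _ _ => by ring
    _ ≤ (∑ a : T → Ω, ∏ v, μ.real {a v}) * ((Fintype.card V).choose k * q ^ k) := by
        gcongr
        · exact Finset.subset_univ G
        · rw [Finset.card_powersetCard]
          exact Nat.choose_le_choose k (Finset.card_le_univ _)
    _ = (Fintype.card V).choose k * q ^ k := by
        have h : ∑ x : Ω, μ.real {x} = 1 := by simp
        have h2 := Finset.sum_prod_piFinset (ι := T) (Finset.univ : Finset Ω)
          (fun _ x => μ.real {x})
        rw [Fintype.piFinset_univ] at h2
        rw [h2]
        simp only [h, Finset.prod_const_one, one_mul]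

variable [DiscreteMeasurableSpace Ω] [Finite Ω]

/-- Each indicator contributes `1 + q(e^t - 1) ≤ exp(q(t + t²))`, because `e^t - 1 - t ≤ t²` for
`|t| ≤ 1`. Both tails below take `|t| = δ/2`, which optimises the exponent to `-δ²/4`. -/
theorem mgf_card_le (E : Set Ω) {t : ℝ} (ht : |t| ≤ 1) :
    mgf (fun S : V → Ω => ({v | S v ∈ E}.ncard : ℝ)) (Measure.pi fun _ : V => μ) t ≤
      Real.exp (Fintype.card V * μ.real E * (t + t ^ 2)) := by
  classical
  set P := Measure.pi fun _ : V => μ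
  have hsum : (fun S : V → Ω => ({v | S v ∈ E}.ncard : ℝ)) =
      ∑ v, fun S : V → Ω => E.indicator (fun _ => (1 : ℝ)) (S v) := by
    ext S
    rw [Set.ncard_eq_toFinset_card', Set.toFinset_ofPred, Finset.sum_apply]
    simp [Set.indicator_apply]
  have hind : iIndepFun (fun (v : V) (S : V → Ω) => E.indicator (fun _ => (1 : ℝ)) (S v)) P :=
    iIndepFun_pi (X := fun _ => E.indicator (fun _ => (1 : ℝ)))
      fun _ => Measurable.of_discrete.aemeasurable
  rw [hsum, hind.mgf_sum fun _ => .of_discrete]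
  have hone : ∀ v, mgf (fun S : V → Ω => E.indicator (fun _ => (1 : ℝ)) (S v)) P t ≤
      Real.exp (μ.real E * (t + t ^ 2)) := by
    intro v
    have h1 : (fun S : V → Ω => Real.exp (t * E.indicator (fun _ => (1 : ℝ)) (S v))) =
        fun S => 1 + {S : V → Ω | S v ∈ E}.indicator (fun _ => Real.exp t - 1) S := by
      ext S
      by_cases h : S v ∈ E <;> simp [h]
    have h2 := Real.abs_exp_sub_one_sub_id_le ht
    rw [mgf, h1, integral_add (integrable_const _) .of_finite, integral_indicator_const _ .of_discrete,
      pi_real_eval]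
    simp only [integral_const, probReal_univ, smul_eq_mul, one_mul]
    refine le_trans ?_ (Real.add_one_le_exp _)
    rw [add_comm]
    gcongr
    linarith [(abs_le.1 h2).2]
  calc _ ≤ ∏ _v : V, Real.exp (μ.real E * (t + t ^ 2)) :=
        Finset.prod_le_prod (fun _ _ => mgf_nonneg) fun v _ => hone v
    _ = _ := by
        rw [Finset.prod_const, Finset.card_univ, ← Real.exp_nat_mul]
        ring_nf

theorem pi_real_card_ge_exp (E : Set Ω) {δ : ℝ} (hδ : 0 < δ) (hδ1 : δ ≤ 1) :
    (Measure.pi fun _ : V => μ).real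
        {S | (1 + δ) * (Fintype.card V * μ.real E) ≤ {v | S v ∈ E}.ncard} ≤
      Real.exp (-(δ ^ 2 / 4 * (Fintype.card V * μ.real E))) := by
  refine (measure_ge_le_exp_mul_mgf (t := δ / 2) _ (by positivity) .of_finite).trans ?_
  refine (mul_le_mul_of_nonneg_left (mgf_card_le μ E (t := δ / 2)
    (by rw [abs_of_pos] <;> linarith)) (Real.exp_pos _).le).trans ?_
  rw [← Real.exp_add]
  refine Real.exp_le_exp.2 (le_of_eq ?_)
  ring

theorem pi_real_card_le_exp (E : Set Ω) {δ : ℝ} (hδ : 0 < δ) (hδ1 : δ ≤ 1) :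
    (Measure.pi fun _ : V => μ).real
        {S | {v | S v ∈ E}.ncard ≤ (1 - δ) * (Fintype.card V * μ.real E)} ≤
      Real.exp (-(δ ^ 2 / 4 * (Fintype.card V * μ.real E))) := by
  refine (measure_le_le_exp_mul_mgf (t := -(δ / 2)) _ (by linarith) .of_finite).trans ?_
  refine (mul_le_mul_of_nonneg_left (mgf_card_le μ E (t := -(δ / 2))
    (by rw [abs_neg, abs_of_pos] <;> linarith)) (Real.exp_pos _).le).trans ?_
  rw [← Real.exp_add]
  refine Real.exp_le_exp.2 (le_of_eq ?_)
  ring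

end Product

/-! ### Common labels of two vertices -/

section Labels

variable {V M : Type*} [Fintype V] [Fintype M] (p : unitInterval)

theorem pi_setBernoulli_real_inter_ge_le {u v : V} (huv : u ≠ v) (k : ℕ) :
    (Measure.pi fun _ : V => setBernoulli (Set.univ : Set M) p).real
        {S | k ≤ (S u ∩ S v).ncard} ≤
      Real.exp (3 * (Fintype.card M * (p : ℝ) ^ 2) - k) := by
  classical
  refine le_trans ?_ (choose_mul_pow_le_exp (Fintype.card M) k (sq_nonneg (p : ℝ)))
  have hsub : {S : V → Set M | k ≤ (S u ∩ S v).ncard} ⊆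
      ⋃ A ∈ (Finset.univ : Finset M).powersetCard k,
        {S | ∀ w, S w ∈ if w ∈ ({u, v} : Finset V) then {s | ∀ l ∈ A, l ∈ s} else Set.univ} := by
    intro S hS
    obtain ⟨A, hA, hAk⟩ := Finset.exists_subset_card_eq
      (show k ≤ (S u ∩ S v).toFinset.card by rw [← Set.ncard_eq_toFinset_card']; exact hS)
    simp only [Set.mem_iUnion]
    refine ⟨A, by simp [hAk], fun w => ?_⟩
    split_ifs with hw
    · intro l hl
      have := hA hl
      simp only [Set.mem_toFinset] at this
      rcases Finset.mem_insert.1 hw with rfl | hw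
      · exact this.1
      · rw [Finset.mem_singleton.1 hw]
        exact this.2
    · trivial
  refine (measureReal_mono hsub (measure_ne_top _ _)).trans
    ((measureReal_biUnion_finset_le _ _).trans ?_)
  rw [Finset.sum_congr rfl (g := fun _ => ((p : ℝ) ^ 2) ^ k)]
  · simp
  · intro A hA
    rw [pi_real_cylinder]
    simp only [apply_ite (setBernoulli (Set.univ : Set M) p).real, setBernoulli_real_subset,
      (Finset.mem_powersetCard.1 hA).2, probReal_univ]
    rw [Finset.prod_ite_mem, Finset.univ_inter, Finset.prod_const, Finset.card_pair huv]
    ring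

end Labels

/-! ### Large cliques contain small spread subsets -/

section Cliques

variable {V M : Type*}

section Repeated

variable [Fintype M]

open Classical in
/-- The labels which occur in the label sets of at least two members of `T`. -/
noncomputable def repeatedLabels {ι : Type*} (S : ι → Set M) (T : Finset ι) : Finset M :=
  Finset.univ.filter fun l => ∃ u ∈ T, ∃ v ∈ T, u ≠ v ∧ l ∈ S u ∧ l ∈ S v

theorem mem_repeatedLabels {ι : Type*} {S : ι → Set M} {T : Finset ι} {l : M} :
    l ∈ repeatedLabels S T ↔ ∃ u ∈ T, ∃ v ∈ T, u ≠ v ∧ l ∈ S u ∧ l ∈ S v := by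
  simp [repeatedLabels]

theorem card_repeatedLabels_le {ι : Type*} {S : ι → Set M} (T : Finset ι) {r : ℕ}
    (h : ∀ u v, u ≠ v → (S u ∩ S v).ncard ≤ r) :
    (repeatedLabels S T).card ≤ T.card ^ 2 * r := by
  classical
  have hsub : repeatedLabels S T ⊆ T.offDiag.biUnion fun x => (S x.1 ∩ S x.2).toFinset := by
    intro l hl
    obtain ⟨u, hu, v, hv, huv, hlu, hlv⟩ := mem_repeatedLabels.1 hl
    exact Finset.mem_biUnion.2 ⟨(u, v), by simp [hu, hv, huv], by simp [hlu, hlv]⟩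
  refine (Finset.card_le_card hsub).trans ((Finset.card_biUnion_le_card_mul _ _ r ?_).trans ?_)
  · intro x hx
    rw [← Set.ncard_eq_toFinset_card']
    exact h _ _ (Finset.mem_offDiag.1 hx).2.2
  · gcongr
    rw [Finset.offDiag_card, pow_two]
    exact Nat.sub_le _ _

open Classical in
/-- If every label is missing from many members of `Q`, then `Q` has a small subset with the same
property. -/
theorem exists_spread_subset (S : V → Set M) (Q : Finset V) {r : ℕ}
    (h : ∀ u v, u ≠ v → (S u ∩ S v).ncard ≤ r)
    (hmiss : ∀ l, r ≤ (Q.filter fun v => l ∉ S v).card) (hQ : 2 * r + 4 * r ^ 4 ≤ Q.card) :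
    ∃ T ⊆ Q, T.card = 2 * r + 4 * r ^ 4 ∧ ∀ l, r ≤ (T.filter fun v => l ∉ S v).card := by
  -- A label not repeated in `T₀` is held by at most one of its `2r` members, so it is missed often
  -- enough. The at most `4r³` repeated labels are repaired by adding `r` members missing each, at a
  -- cost of `4r⁴`.
  obtain ⟨T₀, hT₀Q, hT₀⟩ := Finset.exists_subset_card_eq (show 2 * r ≤ Q.card by omega)
  choose W hWQ hW using fun l => Finset.exists_subset_card_eq (hmiss l)
  have hD := card_repeatedLabels_le T₀ h
  have hU : T₀ ∪ (repeatedLabels S T₀).biUnion W ⊆ Q :=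
    Finset.union_subset hT₀Q (Finset.biUnion_subset.2 fun l _ =>
      (hWQ l).trans (Finset.filter_subset _ _))
  have hUc : (T₀ ∪ (repeatedLabels S T₀).biUnion W).card ≤ 2 * r + 4 * r ^ 4 := by
    refine (Finset.card_union_le _ _).trans ?_
    rw [hT₀]
    gcongr
    refine (Finset.card_biUnion_le_card_mul _ _ r fun l _ => (hW l).le).trans ?_
    calc _ ≤ (T₀.card ^ 2 * r) * r := by gcongr
      _ = 4 * r ^ 4 := by rw [hT₀]; ring
  obtain ⟨T, hUT, hTQ, hT⟩ := Finset.exists_subsuperset_card_eq hU hUc hQ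
  refine ⟨T, hTQ, hT, fun l => ?_⟩
  by_cases hl : l ∈ repeatedLabels S T₀
  · rw [← hW l]
    refine Finset.card_le_card fun v hv => ?_
    exact Finset.mem_filter.2 ⟨hUT (Finset.mem_union_right _ (Finset.mem_biUnion.2 ⟨l, hl, hv⟩)),
      (Finset.mem_filter.1 (hWQ l hv)).2⟩
  · have h1 : (T₀.filter fun v => l ∈ S v).card ≤ 1 := by
      rw [Finset.card_le_one]
      intro u hu v hv
      by_contra huv
      rw [Finset.mem_filter] at hu hv
      exact hl (mem_repeatedLabels.2 ⟨u, hu.1, v, hv.1, huv, hu.2, hv.2⟩)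
    have h2 := Finset.card_filter_add_card_filter_not (s := T₀) fun v => l ∈ S v
    have h3 : (T₀.filter fun v => l ∉ S v).card ≤ (T.filter fun v => l ∉ S v).card :=
      Finset.card_le_card (Finset.filter_subset_filter _ (Finset.subset_union_left.trans hUT))
    omega

end Repeated

/-- The label sets indexed by `ι` are small, have small pairwise intersections, and every label is
missing from many of them. -/
structure IsSpread {ι : Type*} (a : ι → Set M) (r s : ℕ) : Prop where
  inter_le : ∀ i j, i ≠ j → (a i ∩ a j).ncard ≤ r
  card_le : ∀ i, (a i).ncard ≤ s
  missing : ∀ l, r ≤ {i | l ∉ a i}.ncard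

/-- The vertices of `T` have spread label sets but at least `k` common neighbours. -/
def IsCrowded (S : V → Set M) (r s k : ℕ) (T : Finset V) : Prop :=
  IsSpread (fun v : T => S v) r s ∧ k ≤ {u | u ∉ T ∧ S u ∈ {t | ∀ v : T, (t ∩ S v).Nonempty}}.ncard

theorem isClique_filter_mem (S : V → Set M) (l : M) (Q : Finset V) (hQ : ∀ v ∈ Q, l ∈ S v) :
    (intersectionGraph S).IsClique Q :=
  fun u hu v hv huv => ⟨huv, l, hQ u hu, hQ v hv⟩

variable [Fintype V] [Fintype M]

/-- By `hlab`, every label is missing from at least `r` members of `Q`, so a large `Q` would have a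
spread subset `T` whose common neighbours include all of `Q \ T`. -/
theorem isClique_card_lt (S : V → Set M) {r s k : ℕ}
    (hinter : ∀ u v, u ≠ v → (S u ∩ S v).ncard ≤ r) (hcard : ∀ v, (S v).ncard ≤ s)
    (hT : ∀ T : Finset V, T.card = 2 * r + 4 * r ^ 4 → ¬ IsCrowded S r s k T)
    {Q : Finset V} (hQ : (intersectionGraph S).IsClique Q)
    (hlab : ∀ l, {v | l ∈ S v}.ncard + r ≤ Q.card) :
    Q.card < 2 * r + 4 * r ^ 4 + k := by
  classical
  by_contra! hcon
  have hmiss : ∀ l, r ≤ (Q.filter fun v => l ∉ S v).card := by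
    intro l
    have h1 := Finset.card_filter_add_card_filter_not (s := Q) fun v => l ∈ S v
    have h2 : (Q.filter fun v => l ∈ S v).card ≤ {v | l ∈ S v}.ncard := by
      rw [← Set.ncard_coe_finset]
      exact Set.ncard_le_ncard (fun v hv => by simpa using (Finset.mem_filter.1 hv).2)
    have := hlab l
    omega
  obtain ⟨T, hTQ, hTc, hTm⟩ := exists_spread_subset S Q hinter hmiss (by omega)
  refine hT T hTc ⟨⟨fun i j hij => hinter _ _ fun h => hij (Subtype.ext h), fun i => hcard _,
    fun l => (hTm l).trans ?_⟩, ?_⟩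
  · rw [Set.ncard_eq_toFinset_card', Set.toFinset_ofPred]
    refine Finset.card_le_card_of_surjOn (fun v => (v : V)) ?_
    intro v hv
    have hv' := Finset.mem_filter.1 (Finset.mem_coe.1 hv)
    exact ⟨⟨v, hv'.1⟩, by simpa using hv'.2, rfl⟩
  · have h1 : (Q \ T).card + T.card = Q.card := Finset.card_sdiff_add_card_eq_card hTQ
    refine (show k ≤ (Q \ T).card by omega).trans ?_
    rw [← Set.ncard_coe_finset]
    refine Set.ncard_le_ncard fun u hu => ?_
    have hu' := Finset.mem_sdiff.1 (Finset.mem_coe.1 hu)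
    refine ⟨hu'.2, fun v => ?_⟩
    exact (hQ hu'.1 (hTQ v.2) fun h => hu'.2 (h ▸ v.2)).2

/-- Once the label sets on `T` are revealed and spread, the common neighbours outside `T` are
independent trials, with success chance bounded through the at most `d` repeated labels. -/
theorem pi_setBernoulli_real_isCrowded_le (p : unitInterval) {r s k d : ℕ} (T : Finset V)
    (hrT : r ≤ T.card) (hd : T.card ^ 2 * r ≤ d) :
    (Measure.pi fun _ : V => setBernoulli (Set.univ : Set M) p).real
        {S | IsCrowded S r s k T} ≤
      Real.exp (3 * (Fintype.card V * (d ^ 2 * (p : ℝ) ^ 2 +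
        d * (p * (1 - (1 - (p : ℝ)) ^ s) ^ r) + (1 - (1 - (p : ℝ)) ^ s) ^ r)) - k) := by
  have hp0 : (0 : ℝ) ≤ p := p.2.1
  have hp1 : (p : ℝ) ≤ 1 := p.2.2
  have hq0 : 0 ≤ 1 - (1 - (p : ℝ)) ^ s := sub_nonneg.2 (pow_le_one₀ (by linarith) (by linarith))
  have hq : 0 ≤ d ^ 2 * (p : ℝ) ^ 2 + d * (p * (1 - (1 - (p : ℝ)) ^ s) ^ r) +
      (1 - (1 - (p : ℝ)) ^ s) ^ r := by positivity
  refine le_trans ?_ (choose_mul_pow_le_exp (Fintype.card V) k hq)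
  refine pi_real_card_ge_le _ T (fun a => IsSpread a r s)
    (fun a => {t | ∀ v : T, (t ∩ a v).Nonempty}) (fun a ha => ?_) hq k
  refine setBernoulli_real_forall_nonempty_le p a (repeatedLabels a Finset.univ)
    (fun i j l hij hi hj => mem_repeatedLabels.2 ⟨i, by simp, j, by simp, hij, hi, hj⟩)
    ((card_repeatedLabels_le _ ha.inter_le).trans (by simpa using hd)) ha.card_le (by simpa using hrT)
    ha.missing

end Cliques

/-! ### Typical label choices determine the clique number -/

section Typical

/-- The properties of a typical choice of label sets from which the clique number is determined. -/
structure IsTypical {n m : ℕ} (S : Fin n → Set (Fin m)) (r s k : ℕ) (a b : ℝ) : Prop where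
  inter_le : ∀ u v, u ≠ v → (S u ∩ S v).ncard ≤ r
  card_le : ∀ v, (S v).ncard ≤ s
  lt_label : ∀ l, a < {v | l ∈ S v}.ncard
  label_lt : ∀ l, {v | l ∈ S v}.ncard < b
  not_isCrowded : ∀ T : Finset (Fin n), T.card = 2 * r + 4 * r ^ 4 → ¬ IsCrowded S r s k T

theorem labelLaw_real_not_isTypical_le {n m : ℕ} (p : unitInterval) {r s k d : ℕ} {δ : ℝ}
    (hδ : 0 < δ) (hδ1 : δ ≤ 1) (hd : (2 * r + 4 * r ^ 4) ^ 2 * r ≤ d) :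
    (labelLaw n m p).real
        {S | ¬ IsTypical S r s k ((1 - δ) * (n * (p : ℝ))) ((1 + δ) * (n * (p : ℝ)))} ≤
      (n : ℝ) ^ 2 * Real.exp (3 * (m * (p : ℝ) ^ 2) - r) + n * Real.exp (3 * (m * (p : ℝ)) - s) +
      2 * (m * Real.exp (-(δ ^ 2 / 4 * (n * (p : ℝ))))) +
      (n : ℝ) ^ (2 * r + 4 * r ^ 4) * Real.exp (3 * (n * (d ^ 2 * (p : ℝ) ^ 2 +
        d * (p * (1 - (1 - (p : ℝ)) ^ s) ^ r) + (1 - (1 - (p : ℝ)) ^ s) ^ r)) - k) := by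
  classical
  set P := labelLaw n m p with hP
  let E1 : Set (Fin n → Set (Fin m)) := ⋃ x ∈ (Finset.univ : Finset (Fin n)).offDiag,
    {S | r ≤ (S x.1 ∩ S x.2).ncard}
  let E2 : Set (Fin n → Set (Fin m)) := ⋃ v ∈ (Finset.univ : Finset (Fin n)),
    {S | S v ∈ {t | s ≤ t.ncard}}
  let E3 : Set (Fin n → Set (Fin m)) := ⋃ l ∈ (Finset.univ : Finset (Fin m)),
    {S | ({v | S v ∈ {t : Set (Fin m) | l ∈ t}}.ncard : ℝ) ≤ (1 - δ) * (n * (p : ℝ))}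
  let E4 : Set (Fin n → Set (Fin m)) := ⋃ l ∈ (Finset.univ : Finset (Fin m)),
    {S | (1 + δ) * (n * (p : ℝ)) ≤ ({v | S v ∈ {t : Set (Fin m) | l ∈ t}}.ncard : ℝ)}
  let E5 : Set (Fin n → Set (Fin m)) :=
    ⋃ T ∈ (Finset.univ : Finset (Fin n)).powersetCard (2 * r + 4 * r ^ 4),
      {S | IsCrowded S r s k T}
  have hsub : {S | ¬ IsTypical S r s k ((1 - δ) * (n * (p : ℝ))) ((1 + δ) * (n * (p : ℝ)))} ⊆
      E1 ∪ E2 ∪ (E3 ∪ E4) ∪ E5 := by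
    intro S hS
    by_contra hcon
    simp only [Set.mem_union, not_or, E1, E2, E3, E4, E5, Set.mem_iUnion, not_exists,
      Set.mem_ofPred_eq, Finset.mem_univ, true_imp_iff, not_le] at hcon
    obtain ⟨⟨⟨h1, h2⟩, h3, h4⟩, h5⟩ := hcon
    exact hS ⟨fun u v huv => (h1 (u, v) (by simp [huv])).le, fun v => (h2 v).le, h3, h4,
      fun T hT => h5 T (by simp [hT])⟩
  have hE1 : P.real E1 ≤ (n : ℝ) ^ 2 * Real.exp (3 * (m * (p : ℝ) ^ 2) - r) := by
    refine (measureReal_biUnion_finset_le _ _).trans ((Finset.sum_le_card_nsmul _ _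
      (Real.exp (3 * (m * (p : ℝ) ^ 2) - r)) fun x hx => ?_).trans ?_)
    · have := pi_setBernoulli_real_inter_ge_le (M := Fin m) p (Finset.mem_offDiag.1 hx).2.2 r
      simpa [hP, labelLaw] using this
    · rw [nsmul_eq_mul]
      gcongr
      rw [Finset.offDiag_card, pow_two]
      simp only [Finset.card_univ, Fintype.card_fin]
      exact_mod_cast Nat.sub_le _ _
  have hE2 : P.real E2 ≤ n * Real.exp (3 * (m * (p : ℝ)) - s) := by
    refine (measureReal_biUnion_finset_le _ _).trans ((Finset.sum_le_card_nsmul _ _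
      (Real.exp (3 * (m * (p : ℝ)) - s)) fun v _ => ?_).trans ?_)
    · have := setBernoulli_real_card_ge_le (M := Fin m) p s
      rw [hP, labelLaw, pi_real_eval]
      simpa using this
    · simp
  have hE3 : P.real E3 ≤ m * Real.exp (-(δ ^ 2 / 4 * (n * (p : ℝ)))) := by
    refine (measureReal_biUnion_finset_le _ _).trans ((Finset.sum_le_card_nsmul _ _
      (Real.exp (-(δ ^ 2 / 4 * (n * (p : ℝ))))) fun l _ => ?_).trans ?_)
    · have := pi_real_card_le_exp (V := Fin n) (setBernoulli (Set.univ : Set (Fin m)) p)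
        {t | l ∈ t} hδ hδ1
      rw [setBernoulli_real_mem, Fintype.card_fin] at this
      exact this
    · simp
  have hE4 : P.real E4 ≤ m * Real.exp (-(δ ^ 2 / 4 * (n * (p : ℝ)))) := by
    refine (measureReal_biUnion_finset_le _ _).trans ((Finset.sum_le_card_nsmul _ _
      (Real.exp (-(δ ^ 2 / 4 * (n * (p : ℝ))))) fun l _ => ?_).trans ?_)
    · have := pi_real_card_ge_exp (V := Fin n) (setBernoulli (Set.univ : Set (Fin m)) p)
        {t | l ∈ t} hδ hδ1
      rw [setBernoulli_real_mem, Fintype.card_fin] at this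
      exact this
    · simp
  have hE5 : P.real E5 ≤ (n : ℝ) ^ (2 * r + 4 * r ^ 4) * Real.exp (3 * (n * (d ^ 2 * (p : ℝ) ^ 2 +
        d * (p * (1 - (1 - (p : ℝ)) ^ s) ^ r) + (1 - (1 - (p : ℝ)) ^ s) ^ r)) - k) := by
    refine (measureReal_biUnion_finset_le _ _).trans ((Finset.sum_le_card_nsmul _ _
      (Real.exp (3 * (n * (d ^ 2 * (p : ℝ) ^ 2 +
        d * (p * (1 - (1 - (p : ℝ)) ^ s) ^ r) + (1 - (1 - (p : ℝ)) ^ s) ^ r)) - k))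
      fun T hT => ?_).trans ?_)
    · have hTc := (Finset.mem_powersetCard.1 hT).2
      have := pi_setBernoulli_real_isCrowded_le (V := Fin n) (M := Fin m) p (r := r) (s := s)
        (k := k) (d := d) T (by rw [hTc]; omega) (by rwa [hTc])
      rw [Fintype.card_fin] at this
      exact this
    · rw [nsmul_eq_mul, Finset.card_powersetCard, Finset.card_univ, Fintype.card_fin]
      gcongr
      exact_mod_cast Nat.choose_le_pow n _
  calc _ ≤ P.real (E1 ∪ E2 ∪ (E3 ∪ E4) ∪ E5) := measureReal_mono hsub (measure_ne_top _ _)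
    _ ≤ P.real E1 + P.real E2 + (P.real E3 + P.real E4) + P.real E5 := by
      refine (measureReal_union_le _ _).trans (add_le_add_left ?_ _)
      exact (measureReal_union_le _ _).trans (add_le_add (measureReal_union_le _ _)
        (measureReal_union_le _ _))
    _ ≤ _ := by linarith

/-- The holders of any label give the lower bound. A clique above the upper bound exceeds every
label class by `r`, hence has fewer than `2r + 4r⁴ + k ≤ x` members, which is absurd. -/
theorem IsTypical.abs_sub_le {n m : ℕ} {S : Fin n → Set (Fin m)} {r s k : ℕ} {δ x : ℝ}
    (h : IsTypical S r s k ((1 - δ) * x) ((1 + δ) * x)) (hm : 0 < m) (hx : 0 ≤ x)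
    (hδ : 0 ≤ δ) (hrx : r ≤ δ * x) (hkx : (2 * r + 4 * r ^ 4 + k : ℝ) ≤ x)
    {Q : Finset (Fin n)} (hQ : (intersectionGraph S).IsMaximumClique Q) :
    |(Q.card : ℝ) - x| ≤ 2 * δ * x := by
  classical
  have hδx : 0 ≤ δ * x := mul_nonneg hδ hx
  rw [abs_le]
  constructor
  · let l : Fin m := ⟨0, hm⟩
    have h1 := hQ.maximum (Finset.univ.filter fun v => l ∈ S v)
      (isClique_filter_mem S l _ fun v hv => (Finset.mem_filter.1 hv).2)
    have h2 := h.lt_label l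
    rw [Set.ncard_eq_toFinset_card', Set.toFinset_ofPred] at h2
    have h3 : ((Finset.univ.filter fun v => l ∈ S v).card : ℝ) ≤ Q.card := by exact_mod_cast h1
    linarith
  · by_contra! hcon
    have h1 := isClique_card_lt S h.inter_le h.card_le h.not_isCrowded hQ.isClique (fun l => by
      have := h.label_lt l
      have h4 : ({v | l ∈ S v}.ncard : ℝ) + r ≤ Q.card := by linarith
      exact_mod_cast h4)
    have h2 : (Q.card : ℝ) < 2 * r + 4 * r ^ 4 + k := by exact_mod_cast h1
    linarith

end Typical

/-! ### Typical label choices have probability tending to one -/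

section Asymptotics

/-- From `1 - p ≥ exp(-2p)`, valid for `p ≤ 1/2`, one gets `(1 - p)^s ≥ η` with `η = exp(-2c)`, and
`1 - η ≤ exp(-η)`. The exponential form makes `q^r` decay like `exp(-ηr)`. -/
theorem one_sub_one_sub_pow_le {p : ℝ} (hp : 0 ≤ p) (hp1 : p ≤ 1 / 2) {s : ℕ} {c : ℝ}
    (hs : p * s ≤ c) : 1 - (1 - p) ^ s ≤ Real.exp (-Real.exp (-(2 * c))) := by
  have h1 : Real.exp (-(2 * p)) ≤ 1 - p := by
    rw [Real.exp_neg]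
    have h2 := Real.add_one_le_exp (2 * p)
    have h3 : 0 < 2 * p + 1 := by linarith
    refine (inv_anti₀ h3 h2).trans ?_
    rw [inv_le_iff_one_le_mul₀ h3]
    nlinarith
  have h2 : Real.exp (-(2 * c)) ≤ (1 - p) ^ s := by
    calc Real.exp (-(2 * c)) ≤ Real.exp (s * -(2 * p)) := Real.exp_le_exp.2 (by linarith)
      _ = Real.exp (-(2 * p)) ^ s := Real.exp_nat_mul _ _
      _ ≤ (1 - p) ^ s := by gcongr
  have h3 := Real.add_one_le_exp (-Real.exp (-(2 * c)))
  linarith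

theorem tendsto_zero_of_sq_le_rpow {f : ℕ → ℝ} {K b : ℝ} (hb : 0 < b)
    (h : ∀ᶠ n : ℕ in atTop, f n ^ 2 ≤ K * (n : ℝ) ^ (-b)) : Tendsto f atTop (nhds 0) := by
  have h1 : Tendsto (fun n : ℕ => K * (n : ℝ) ^ (-b)) atTop (nhds 0) := by
    simpa using ((tendsto_rpow_neg_atTop hb).comp tendsto_natCast_atTop_atTop).const_mul K
  have h2 : Tendsto (fun n => f n ^ 2) atTop (nhds 0) :=
    squeeze_zero' (Eventually.of_forall fun n => sq_nonneg _) h h1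
  have h3 := h2.sqrt
  simp only [Real.sqrt_sq_eq_abs, Real.sqrt_zero] at h3
  exact tendsto_zero_iff_abs_tendsto_zero _ |>.2 h3

theorem tendsto_sq_mul_exp_neg_ceil_rpow {γ : ℝ} (hγ : 0 < γ) {c : ℝ} (hc : 0 < c) :
    Tendsto (fun n : ℕ => (n : ℝ) ^ 2 * Real.exp (-(c * (⌈(n : ℝ) ^ γ⌉₊ : ℝ)))) atTop (nhds 0) := by
  have h1 := (tendsto_rpow_mul_exp_neg_mul_atTop_nhds_zero (2 / γ) c hc).comp
    ((tendsto_rpow_atTop hγ).comp tendsto_natCast_atTop_atTop)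
  refine squeeze_zero (fun n => by positivity) (fun n => ?_) h1
  have h2 : ((n : ℝ) ^ γ) ^ (2 / γ) = (n : ℝ) ^ 2 := by
    rw [← Real.rpow_mul (Nat.cast_nonneg n), mul_div_cancel₀ _ hγ.ne']
    norm_cast
  simp only [Function.comp_apply, h2]
  gcongr
  rw [neg_mul, neg_le_neg_iff]
  gcongr
  exact Nat.le_ceil _

theorem tendsto_real_not_isTypical {m : ℕ → ℕ} {p : ℕ → unitInterval} {r : ℕ → ℕ} {C δ : ℝ}
    (hC : 1 ≤ C) (hδ : 0 < δ) (hδ1 : δ ≤ 1) (hr : Tendsto r atTop atTop)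
    (hexp : ∀ c : ℝ, 0 < c →
      Tendsto (fun n : ℕ => (n : ℝ) ^ 2 * Real.exp (-(c * (r n : ℝ)))) atTop (nhds 0))
    (hrp : Tendsto (fun n => (r n : ℝ) ^ 18 * (p n : ℝ)) atTop (nhds 0))
    (hrn : ∀ᶠ n : ℕ in atTop, 100 * (r n : ℝ) ^ 5 ≤ n * (p n : ℝ))
    (hmp : ∀ᶠ n : ℕ in atTop, (m n : ℝ) * (p n : ℝ) ^ 2 ≤ C)
    (hmn : ∀ᶠ n : ℕ in atTop, (m n : ℝ) ≤ 2 * n) :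
    Tendsto (fun n => (labelLaw n (m n) (p n)).real
      {S | ¬ IsTypical S (r n) ⌈4 * C / (p n : ℝ)⌉₊ ⌈(n : ℝ) * (p n : ℝ) / 2⌉₊
        ((1 - δ) * (n * (p n : ℝ))) ((1 + δ) * (n * (p n : ℝ)))}) atTop (nhds 0) := by
  set η : ℝ := Real.exp (-(2 * (4 * C + 1))) with hη
  have hη0 : 0 < η := Real.exp_pos _
  have hlim : Tendsto (fun n : ℕ => Real.exp (3 * C) * ((n : ℝ) ^ 2 * Real.exp (-(1 * (r n : ℝ)))) +
      (n : ℝ) ^ 2 * Real.exp (-(1 * (r n : ℝ))) +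
      4 * ((n : ℝ) ^ 2 * Real.exp (-(δ ^ 2 / 4 * (r n : ℝ)))) +
      (n : ℝ) ^ 2 * Real.exp (-(1 * (r n : ℝ)))) atTop (nhds 0) := by
    have h1 := hexp 1 one_pos
    have h2 := hexp (δ ^ 2 / 4) (by positivity)
    simpa using (((h1.const_mul (Real.exp (3 * C))).add h1).add (h2.const_mul 4)).add h1
  have hpoly : Tendsto (fun n => (r n : ℝ) ^ 9 * Real.exp (-(η * (r n : ℝ)))) atTop (nhds 0) := by
    have h := (tendsto_rpow_mul_exp_neg_mul_atTop_nhds_zero 9 η hη0).comp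
      (tendsto_natCast_atTop_atTop.comp hr)
    refine h.congr fun n => ?_
    simp only [Function.comp_apply, neg_mul]
    norm_cast
  refine squeeze_zero' (Eventually.of_forall fun n => measureReal_nonneg) ?_ hlim
  filter_upwards [hr.eventually_ge_atTop 1, eventually_ge_atTop 1,
    (hexp 1 one_pos).eventually_le_const one_pos,
    (hexp η hη0).eventually_le_const (show (0 : ℝ) < 1 / 36 by norm_num),
    hrp.eventually_le_const (show (0 : ℝ) < 1 / 46656 by norm_num), hrn, hmp, hmn,
    hpoly.eventually_le_const (show (0 : ℝ) < 1 / 1296 by norm_num)] with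
    n hr1 hn1 he1 heη hrp hrn hmp hmn hpoly
  generalize r n = r at *
  have hpp := (p n).2.1
  have hd : (2 * r + 4 * r ^ 4) ^ 2 * r ≤ 36 * r ^ 9 := by
    have : r ≤ r ^ 4 := Nat.le_self_pow (by norm_num) r
    calc (2 * r + 4 * r ^ 4) ^ 2 * r ≤ (2 * r ^ 4 + 4 * r ^ 4) ^ 2 * r := by gcongr
      _ = 36 * r ^ 9 := by ring
  refine (labelLaw_real_not_isTypical_le (p n) hδ hδ1 hd).trans ?_
  generalize (p n : ℝ) = x at *
  have hr1' : (1 : ℝ) ≤ r := by exact_mod_cast hr1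
  have hn1' : (1 : ℝ) ≤ n := by exact_mod_cast hn1
  have hn2 : (n : ℝ) ≤ (n : ℝ) ^ 2 := le_self_pow₀ hn1' (by norm_num)
  have hr5 : (r : ℝ) ≤ (r : ℝ) ^ 5 := le_self_pow₀ hr1' (by norm_num)
  have hr18 : (r : ℝ) ≤ (r : ℝ) ^ 18 := le_self_pow₀ hr1' (by norm_num)
  have hr4 : (r : ℝ) ≤ (r : ℝ) ^ 4 := le_self_pow₀ hr1' (by norm_num)
  have hnx : (r : ℝ) ≤ n * x := by linarith
  have hx : 0 < x := by
    by_contra! hx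
    nlinarith
  have hrx : r * x ≤ 1 := by
    have : r * x ≤ r ^ 18 * x := by gcongr
    linarith
  have hx1 : x ≤ 1 / 46656 := by
    have : 1 * x ≤ r ^ 18 * x := by gcongr; linarith
    linarith
  have hCx : r ≤ C / x := by
    rw [le_div_iff₀ hx]
    linarith
  -- The factor `4` in `s` leaves a spare `C / x ≥ r` above `3mp`, so the tail for label set sizes
  -- is at most `exp(-r)`.
  have hmx : 3 * (m n * x) ≤ 3 * (C / x) := by
    have : m n * x ≤ C / x := by
      rw [le_div_iff₀ hx]
      linarith
    linarith
  have hs := Nat.le_ceil (4 * C / x)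
  have hs' := (Nat.ceil_lt_add_one (show 0 ≤ 4 * C / x by positivity)).le
  have hk := Nat.le_ceil (n * x / 2)
  generalize ⌈4 * C / x⌉₊ = s at *
  generalize ⌈n * x / 2⌉₊ = k at *
  have hxs : x * s ≤ 4 * C + 1 := by
    calc x * s ≤ x * (4 * C / x + 1) := by gcongr
      _ = 4 * C + x := by field_simp
      _ ≤ 4 * C + 1 := by linarith
  have hq := one_sub_one_sub_pow_le hx.le (by linarith) hxs
  rw [← hη] at hq
  have hq0 : 0 ≤ 1 - (1 - x) ^ s := sub_nonneg.2 (pow_le_one₀ (by linarith) (by linarith))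
  generalize 1 - (1 - x) ^ s = q at *
  have hqr : q ^ r ≤ Real.exp (-(η * r)) := by
    calc q ^ r ≤ Real.exp (-η) ^ r := by gcongr
      _ = Real.exp (-(η * r)) := by rw [← Real.exp_nat_mul]; ring_nf
  -- The power `r ^ 18` in the hypothesis on `p` comes from `d²`. Each of the three terms gets `x /
  -- 36`, for a total of `x / 12`.
  have hA : ((36 * r ^ 9 : ℕ) : ℝ) ^ 2 * x ^ 2 ≤ x / 36 := by
    push_cast
    calc (36 * (r : ℝ) ^ 9) ^ 2 * x ^ 2 = 1296 * (r ^ 18 * x) * x := by ring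
      _ ≤ 1296 * (1 / 46656) * x := by gcongr
      _ = x / 36 := by ring
  have hB : ((36 * r ^ 9 : ℕ) : ℝ) * (x * q ^ r) ≤ x / 36 := by
    push_cast
    calc 36 * (r : ℝ) ^ 9 * (x * q ^ r) ≤ 36 * (r : ℝ) ^ 9 * (x * Real.exp (-(η * r))) := by gcongr
      _ = 36 * (r ^ 9 * Real.exp (-(η * r))) * x := by ring
      _ ≤ 36 * (1 / 1296) * x := by gcongr
      _ = x / 36 := by ring
  have hD : q ^ r ≤ x / 36 := by
    refine hqr.trans ?_
    have h1 : (n : ℝ) * Real.exp (-(η * r)) ≤ 1 / 36 :=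
      (mul_le_mul_of_nonneg_right hn2 (Real.exp_pos _).le).trans heη
    have h2 : (n : ℝ) * Real.exp (-(η * r)) ≤ n * (x / 36) := by linarith
    exact le_of_mul_le_mul_left h2 (by linarith)
  have hnexp : (n : ℝ) ≤ Real.exp r := by
    rw [one_mul, Real.exp_neg, mul_inv_le_iff₀ (Real.exp_pos _), one_mul] at he1
    linarith
  have hpow : (n : ℝ) ^ (2 * r + 4 * r ^ 4) ≤ Real.exp (6 * r ^ 5) := by
    calc (n : ℝ) ^ (2 * r + 4 * r ^ 4) ≤ Real.exp r ^ (2 * r + 4 * r ^ 4) := by gcongr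
      _ = Real.exp ((2 * r + 4 * r ^ 4) * r) := by rw [← Real.exp_nat_mul]; push_cast; rfl
      _ ≤ Real.exp ((2 * r ^ 4 + 4 * r ^ 4) * r) := by gcongr
      _ = Real.exp (6 * r ^ 5) := by ring_nf
  gcongr ?_ + ?_ + ?_ + ?_
  · calc (n : ℝ) ^ 2 * Real.exp (3 * (m n * x ^ 2) - r) ≤ (n : ℝ) ^ 2 * Real.exp (3 * C - r) := by gcongr
      _ = _ := by rw [sub_eq_add_neg, Real.exp_add, one_mul]; ring
  · gcongr
    have : 4 * C / x = 4 * (C / x) := by ring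
    linarith
  · calc 2 * (m n * Real.exp (-(δ ^ 2 / 4 * (n * x))))
        ≤ 2 * (2 * (n : ℝ) ^ 2 * Real.exp (-(δ ^ 2 / 4 * r))) := by
          gcongr
          linarith
      _ = _ := by ring
  · set d : ℝ := ((36 * r ^ 9 : ℕ) : ℝ)
    -- The exponent is then at most `nx/4 - nx/2 = -nx/4 ≤ -25r⁵`, against `6r⁵` for the choice of
    -- `T`.
    have h1 : (n : ℝ) * (d ^ 2 * x ^ 2 + d * (x * q ^ r) + q ^ r) ≤ n * (x / 12) := by
      gcongr
      linarith
    calc (n : ℝ) ^ (2 * r + 4 * r ^ 4) *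
          Real.exp (3 * (n * (d ^ 2 * x ^ 2 + d * (x * q ^ r) + q ^ r)) - k)
        ≤ Real.exp (6 * r ^ 5) * Real.exp (-(25 * r ^ 5)) := by
          gcongr
          linarith
      _ = 1 * Real.exp (6 * r ^ 5 + -(25 * r ^ 5)) := by rw [← Real.exp_add, one_mul]
      _ ≤ (n : ℝ) ^ 2 * Real.exp (-(1 * r)) := by
          gcongr
          · linarith
          · linarith

end Asymptotics

/-! ### The main theorem: choice of `γ` and growth rates -/

theorem corollary3 (α : ℝ) (hα0 : 0 < α) (hα1 : α < 1)
    (m : ℕ → ℕ) (hm : ∀ n : ℕ, |(m n : ℝ) - (n : ℝ) ^ α| < 1)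
    (p : ℕ → unitInterval)
    (hp : (fun n : ℕ => √(1 / ((n : ℝ) * (m n : ℝ)))) =O[atTop] fun n : ℕ => (p n : ℝ))
    (hmp : (fun n : ℕ => (m n : ℝ) * (p n : ℝ) ^ 2) =O[atTop] fun _ : ℕ => (1 : ℝ)) :
    ∀ ε : ℝ, 0 < ε →
      Tendsto
        (fun n : ℕ => labelLaw n (m n) (p n)
          {S | (∀ Q : Finset (Fin n), (intersectionGraph S).IsMaximumClique Q →
                |(Q.card : ℝ) - (n : ℝ) * (p n : ℝ)| ≤ ε * ((n : ℝ) * (p n : ℝ))) ∧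
              |((intersectionGraph S).cliqueNum : ℝ) - (n : ℝ) * (p n : ℝ)|
                ≤ ε * ((n : ℝ) * (p n : ℝ))})
        atTop (nhds 1) := by
  intro ε hε
  obtain ⟨c, hc, hpc⟩ := hp.exists_pos
  replace hpc := hpc.bound
  obtain ⟨C₀, hC₀⟩ := hmp.bound
  obtain ⟨C, hC, hC₀C⟩ : ∃ C : ℝ, 1 ≤ C ∧ C₀ ≤ C := ⟨max 1 C₀, le_max_left _ _, le_max_right _ _⟩
  obtain ⟨δ, hδ, hδ1, hδε⟩ : ∃ δ : ℝ, 0 < δ ∧ δ ≤ 1 ∧ 2 * δ ≤ ε :=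
    ⟨min ε 1 / 2, by positivity, by linarith [min_le_right ε 1], by linarith [min_le_left ε 1]⟩
  -- The squared estimate `r³⁶p² = O(n^(36γ - α))` needs `36γ ≤ α/2`; the bound on `r⁵/(np)` needs
  -- only `10γ ≤ (1 - α)/2`.
  obtain ⟨γ, hγ, hγα, hγα'⟩ : ∃ γ : ℝ, 0 < γ ∧ 72 * γ ≤ α ∧ 72 * γ ≤ 1 - α :=
    ⟨min α (1 - α) / 72, by have := sub_pos.2 hα1; positivity,
      by linarith [min_le_left α (1 - α)], by linarith [min_le_right α (1 - α)]⟩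
  let r : ℕ → ℕ := fun n => ⌈(n : ℝ) ^ γ⌉₊
  have hrle : ∀ n : ℕ, 1 ≤ n → (r n : ℝ) ≤ 2 * (n : ℝ) ^ γ := by
    intro n hn
    have h1 : (1 : ℝ) ≤ (n : ℝ) ^ γ := Real.one_le_rpow (by exact_mod_cast hn) hγ.le
    have := Nat.ceil_lt_add_one (show 0 ≤ (n : ℝ) ^ γ by positivity)
    simp only [r]
    linarith
  have hm' : ∀ n : ℕ, 1 ≤ n → 0 < m n ∧ (n : ℝ) ^ α ≤ 2 * m n ∧ (m n : ℝ) ≤ 2 * (n : ℝ) ^ α := by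
    intro n hn
    have h1 : (1 : ℝ) ≤ (n : ℝ) ^ α := Real.one_le_rpow (by exact_mod_cast hn) hα0.le
    have h2 := abs_lt.1 (hm n)
    have h3 : 0 < m n := by
      have : (0 : ℝ) < m n := by linarith
      exact_mod_cast this
    have h4 : (1 : ℝ) ≤ m n := by exact_mod_cast h3
    exact ⟨h3, by linarith, by linarith⟩
  have hr : Tendsto r atTop atTop :=
    tendsto_nat_ceil_atTop.comp ((tendsto_rpow_atTop hγ).comp tendsto_natCast_atTop_atTop)
  have hmpC : ∀ᶠ n : ℕ in atTop, (m n : ℝ) * (p n : ℝ) ^ 2 ≤ C := by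
    filter_upwards [hC₀] with n hn
    have := (le_abs_self _).trans hn
    simp only [norm_one, mul_one] at this
    linarith
  have hmn : ∀ᶠ n : ℕ in atTop, (m n : ℝ) ≤ 2 * n := by
    filter_upwards [eventually_ge_atTop 1] with n hn
    have h1 : (n : ℝ) ^ α ≤ (n : ℝ) ^ (1 : ℝ) :=
      Real.rpow_le_rpow_of_exponent_le (by exact_mod_cast hn) hα1.le
    rw [Real.rpow_one] at h1
    linarith [(hm' n hn).2.2]
  have hrp : Tendsto (fun n => (r n : ℝ) ^ 18 * (p n : ℝ)) atTop (nhds 0) := by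
    refine tendsto_zero_of_sq_le_rpow (K := 2 ^ 36 * (2 * C)) (b := α / 2) (by positivity) ?_
    filter_upwards [eventually_ge_atTop 1, hmpC] with n hn hmpC
    have hn0 : (0 : ℝ) < n := by exact_mod_cast hn
    have hn1 : (1 : ℝ) ≤ n := by exact_mod_cast hn
    have hp2 : (p n : ℝ) ^ 2 ≤ 2 * C * (n : ℝ) ^ (-α) := by
      rw [Real.rpow_neg hn0.le, ← div_eq_mul_inv, le_div_iff₀ (by positivity)]
      have := mul_le_mul_of_nonneg_right (hm' n hn).2.1 (sq_nonneg (p n : ℝ))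
      linarith
    have h2 : ((n : ℝ) ^ γ) ^ 36 * (n : ℝ) ^ (-α) ≤ (n : ℝ) ^ (-(α / 2)) := by
      rw [← Real.rpow_natCast, ← Real.rpow_mul hn0.le, ← Real.rpow_add hn0]
      refine Real.rpow_le_rpow_of_exponent_le hn1 ?_
      push_cast
      linarith
    calc ((r n : ℝ) ^ 18 * (p n : ℝ)) ^ 2 = (r n : ℝ) ^ 36 * (p n : ℝ) ^ 2 := by ring
      _ ≤ (2 * (n : ℝ) ^ γ) ^ 36 * (2 * C * (n : ℝ) ^ (-α)) := by
        gcongr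
        exact hrle n hn
      _ = 2 ^ 36 * (2 * C) * (((n : ℝ) ^ γ) ^ 36 * (n : ℝ) ^ (-α)) := by ring
      _ ≤ _ := by gcongr
  -- The lower bound on `p` gives `(np)² ≥ n/(c²m)`, and `m` is at most `2n^α`.
  have hpn : ∀ᶠ n : ℕ in atTop, (n : ℝ) ^ (1 - α) ≤ 2 * c ^ 2 * ((n : ℝ) * (p n : ℝ)) ^ 2 := by
    filter_upwards [eventually_ge_atTop 1, hpc] with n hn hpc
    have hn0 : (0 : ℝ) < n := by exact_mod_cast hn
    obtain ⟨hm0, -, hm2⟩ := hm' n hn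
    have hm0' : (0 : ℝ) < m n := by exact_mod_cast hm0
    rw [Real.norm_of_nonneg (Real.sqrt_nonneg _), Real.norm_of_nonneg (p n).2.1,
      Real.sqrt_le_left (mul_nonneg hc.le (p n).2.1), div_le_iff₀ (by positivity)] at hpc
    rw [Real.rpow_sub hn0, Real.rpow_one, div_le_iff₀ (by positivity)]
    calc (n : ℝ) = n * 1 := (mul_one _).symm
      _ ≤ n * ((c * (p n : ℝ)) ^ 2 * (n * m n)) := by gcongr
      _ = c ^ 2 * (n * (p n : ℝ)) ^ 2 * m n := by ring
      _ ≤ c ^ 2 * (n * (p n : ℝ)) ^ 2 * (2 * (n : ℝ) ^ α) := by gcongr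
      _ = _ := by ring
  have hrn : Tendsto (fun n : ℕ => (r n : ℝ) ^ 5 / (n * (p n : ℝ))) atTop (nhds 0) := by
    refine tendsto_zero_of_sq_le_rpow (K := 2 ^ 10 * (2 * c ^ 2)) (b := (1 - α) / 2)
      (by linarith) ?_
    filter_upwards [eventually_ge_atTop 1, hpn] with n hn hpn
    have hn0 : (0 : ℝ) < n := by exact_mod_cast hn
    have hn1 : (1 : ℝ) ≤ n := by exact_mod_cast hn
    have hpow : 0 < (n : ℝ) ^ (1 - α) := by positivity
    have hsq : 0 < ((n : ℝ) * (p n : ℝ)) ^ 2 := by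
      by_contra! h
      have : 2 * c ^ 2 * ((n : ℝ) * (p n : ℝ)) ^ 2 ≤ 0 :=
        mul_nonpos_of_nonneg_of_nonpos (by positivity) h
      linarith
    have h2 : ((n : ℝ) ^ γ) ^ 10 ≤ (n : ℝ) ^ (-((1 - α) / 2)) * (n : ℝ) ^ (1 - α) := by
      rw [← Real.rpow_natCast, ← Real.rpow_mul hn0.le, ← Real.rpow_add hn0]
      refine Real.rpow_le_rpow_of_exponent_le hn1 ?_
      push_cast
      linarith
    rw [div_pow, div_le_iff₀ hsq]
    calc ((r n : ℝ) ^ 5) ^ 2 = (r n : ℝ) ^ 10 := by ring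
      _ ≤ (2 * (n : ℝ) ^ γ) ^ 10 := by
        gcongr
        exact hrle n hn
      _ = 2 ^ 10 * ((n : ℝ) ^ γ) ^ 10 := by ring
      _ ≤ 2 ^ 10 * ((n : ℝ) ^ (-((1 - α) / 2)) *
            (2 * c ^ 2 * ((n : ℝ) * (p n : ℝ)) ^ 2)) := by
        gcongr
        exact h2.trans (by gcongr)
      _ = _ := by ring
  have hpos : ∀ᶠ n : ℕ in atTop, 0 < (n : ℝ) * (p n : ℝ) := by
    filter_upwards [eventually_ge_atTop 1, hpn] with n hn hpn
    have hn0 : (0 : ℝ) < n := by exact_mod_cast hn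
    have hpow : 0 < (n : ℝ) ^ (1 - α) := by positivity
    refine lt_of_le_of_ne (mul_nonneg hn0.le (p n).2.1) fun h => ?_
    rw [← h] at hpn
    linarith
  have hle : ∀ κ : ℝ, 0 < κ → ∀ᶠ n : ℕ in atTop, (r n : ℝ) ^ 5 ≤ κ * (n * (p n : ℝ)) := by
    intro κ hκ
    filter_upwards [hrn.eventually_le_const hκ, hpos] with n h1 h2
    rwa [div_le_iff₀ h2] at h1
  have hbad := tendsto_real_not_isTypical hC hδ hδ1 hr
    (fun c hc => tendsto_sq_mul_exp_neg_ceil_rpow hγ hc) hrp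
    ((hle (1 / 100) (by norm_num)).mono fun n hn => by linarith) hmpC hmn
  have hreal : Tendsto (fun n : ℕ => (labelLaw n (m n) (p n)).real
      {S | (∀ Q : Finset (Fin n), (intersectionGraph S).IsMaximumClique Q →
            |(Q.card : ℝ) - (n : ℝ) * (p n : ℝ)| ≤ ε * ((n : ℝ) * (p n : ℝ))) ∧
          |((intersectionGraph S).cliqueNum : ℝ) - (n : ℝ) * (p n : ℝ)|
            ≤ ε * ((n : ℝ) * (p n : ℝ))}) atTop (nhds 1) := by
    refine tendsto_of_tendsto_of_tendsto_of_le_of_le' (by simpa using hbad.const_sub 1)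
      tendsto_const_nhds ?_ (Eventually.of_forall fun n => measureReal_le_one)
    filter_upwards [eventually_ge_atTop 1, hr.eventually_ge_atTop 1, hle δ hδ,
      hle (1 / 100) (by norm_num)] with n hn hr1 hδn hn100
    rw [← probReal_compl_eq_one_sub .of_discrete]
    refine measureReal_mono (fun S hS => ?_) (measure_ne_top _ _)
    have hS' := not_not.1 hS
    have hx : 0 ≤ (n : ℝ) * (p n : ℝ) := mul_nonneg (Nat.cast_nonneg n) (p n).2.1
    have hr1' : (1 : ℝ) ≤ r n := by exact_mod_cast hr1
    have hr5 : (r n : ℝ) ≤ (r n : ℝ) ^ 5 := le_self_pow₀ hr1' (by norm_num)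
    have hr45 : (r n : ℝ) ^ 4 ≤ (r n : ℝ) ^ 5 := pow_le_pow_right₀ hr1' (by norm_num)
    have hk := (Nat.ceil_lt_add_one (show 0 ≤ (n : ℝ) * (p n : ℝ) / 2 by positivity)).le
    have hmain : ∀ Q : Finset (Fin n), (intersectionGraph S).IsMaximumClique Q →
        |(Q.card : ℝ) - (n : ℝ) * (p n : ℝ)| ≤ ε * ((n : ℝ) * (p n : ℝ)) := fun Q hQ =>
      (hS'.abs_sub_le (hm' n hn).1 hx hδ.le (by linarith) (by linarith) hQ).trans (by gcongr)
    refine ⟨hmain, ?_⟩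
    obtain ⟨Q, hQ⟩ := (intersectionGraph S).maximumClique_exists
    rw [← SimpleGraph.maximumClique_card_eq_cliqueNum Q hQ]
    exact hmain Q hQ
  have h := ENNReal.tendsto_ofReal hreal
  rw [ENNReal.ofReal_one] at h
  refine h.congr fun n => ?_
  rw [measureReal_def, ENNReal.ofReal_toReal (measure_ne_top _ _)]
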